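/- All hypergraphs are finite. Two vertices of a hypergraph $\mathcal H$ are adjacent if some edge of $\mathcal H$ contains both; the $2$-section of $\mathcal H$ is the graph on $V(\mathcal H)$ joining distinct adjacent vertices, and $\mathcal H$ is connected if its $2$-section is connected. The rank $r(\mathcal H)$ and the anti-rank $s(\mathcal H)$ are the maximum and the minimum size of an edge of $\mathcal H$ (in particular, a hypergraph with anti-rank at least $3$, or with rank at least $2$, has at least one edge). A hypertree is a connected hypergraph $\mathcal T$ for which there is a tree $T$ on the vertex set $V(\mathcal T)$ such that every edge of $\mathcal T$ induces a subtree of $T$. A uniform complete hypergraph is one whose edges are, for some $r$, exactly the $r$-element subsets of its vertex set. The Cartesian product $\mathcal H_1\,\square\cdots\square\,\mathcal H_d$ has vertex set $V(\mathcal H_1)\times\cdots\times V(\mathcal H_d)$, and its edges are the sets obtained by letting one coordinate $i$ range over an edge of $\mathcal H_i$ and fixing every other coordinate $j$ at a vertex of $\mathcal H_j$. In the game of Cops and Robber with $k$ cops on $\mathcal H$, the cops are placed on vertices, then the robber is placed on a vertex. The cops and the robber then take turns alternately, the cops first: on the cops' turn each cop stays or moves to an adjacent vertex, and on the robber's turn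 he stays or moves to an adjacent vertex. Several cops may share a vertex. The cops win if after finitely many moves some cop is on the same vertex as the robber. The cop number $c(\mathcal H)$ is the least $k$ for which $k$ cops have a winning strategy. (a) Let $d\ge 1$ and let $\mathcal T_1,\dots,\mathcal T_d$ be hypertrees, each with anti-rank at least $3$. Then $$c(\mathcal T_1\,\square\cdots\square\,\mathcal T_d)=d.$$ (b) Let $p\ge 0$ and $q\ge 1$. Let $Q_p$ be the discrete cube, that is, the Cartesian product of $p$ copies of the complete graph $K_2$ (a single vertex if $p=0$), and let $\mathcal H_1,\dots,\mathcal H_q$ be uniform complete hypergraphs with $r(\mathcal H_j)\ge 2$ and $|V(\mathcal H_j)|\ge 3$ for all $1\le j\le q$ (different $\mathcal H_j$ may have different ranks). Then $$c(Q_p\,\square\,\mathcal H_1\,\square\cdots\square\,\mathcal H_q)=\Big\lceil\frac p2\Big\rceil+q.$$ -/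

import Mathlib

open scoped Hypergraph

namespace Hypergraph

variable {α β : Type*}

/-- The `2`-section of `H`: the graph on the vertex set of `H` in which two distinct vertices are
adjacent if and only if some edge of `H` contains both. -/
def twoSection (H : Hypergraph α) : SimpleGraph V(H) where
  Adj x y := x ≠ y ∧ H.Adj x y
  symm := ⟨fun _ _ h => ⟨h.1.symm, h.2.symm⟩⟩
  loopless := ⟨fun _ h => h.1 rfl⟩

/-- A hypergraph is connected if its `2`-section is a connected graph (in particular, it has a
vertex). -/
def IsConnected (H : Hypergraph α) : Prop := H.twoSection.Connected

/-- The rank: the maximum size of an edge of a finite hypergraph.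
If there is no edge, the value is the default `0`. -/
noncomputable def rank (H : Hypergraph α) : ℕ := sSup (Set.ncard '' E(H))

/-- The anti-rank: the minimum size of an edge of a finite hypergraph.
If there is no edge, the value is the default `0`, so that `1 ≤ H.antiRank` implies that `H`
has an edge. -/
noncomputable def antiRank (H : Hypergraph α) : ℕ := sInf (Set.ncard '' E(H))

/-- `H` is a hypertree: it is connected, and there is a (host) tree on its vertex set in which every
edge of `H` induces a subtree. -/
def IsHypertree (H : Hypergraph α) : Prop :=
  H.IsConnected ∧ ∃ T : SimpleGraph V(H), T.IsTree ∧
    ∀ e ∈ E(H), (T.induce {x : V(H) | (x : α) ∈ e}).IsTree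

/-- `H` is a uniform complete hypergraph: for some `r`, its edges are exactly the `r`-element
subsets of its vertex set. -/
def IsUniformComplete (H : Hypergraph α) : Prop :=
  ∃ r : ℕ, ∀ e : Set α, e ∈ E(H) ↔ e ⊆ V(H) ∧ e.encard = r

/-- A graph regarded as a hypergraph. -/
def ofSimpleGraph (G : SimpleGraph α) : Hypergraph α where
  vertexSet := Set.univ
  edgeSet := {e | ∃ x y, G.Adj x y ∧ e = {x, y}}
  subset_vertexSet_of_mem_edgeSet' := fun _ _ => Set.subset_univ _

/-- The Cartesian product `G □ H` of two hypergraphs: the edges are the sets `{a} × f` with `a` a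
vertex of `G` and `f` an edge of `H`, and the sets `e × {b}` with `e` an edge of `G` and `b` a
vertex of `H`. -/
def box (G : Hypergraph α) (H : Hypergraph β) : Hypergraph (α × β) where
  vertexSet := V(G) ×ˢ V(H)
  edgeSet := {s | (∃ a ∈ V(G), ∃ f ∈ E(H), s = {a} ×ˢ f) ∨
    (∃ e ∈ E(G), ∃ b ∈ V(H), s = e ×ˢ {b})}
  subset_vertexSet_of_mem_edgeSet' := by
    rintro s (⟨a, ha, f, hf, rfl⟩ | ⟨e, he, b, hb, rfl⟩)
    · exact Set.prod_mono (Set.singleton_subset_iff.2 ha) (subset_vertexSet_of_mem_edgeSet hf)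
    · exact Set.prod_mono (subset_vertexSet_of_mem_edgeSet he) (Set.singleton_subset_iff.2 hb)

/-- The Cartesian product of a family of hypergraphs: in every direction `i`, a copy of `H i` is
put on every line of vertices parallel to that direction. For the empty family it is a
single vertex without edges. -/
def piBox {ι : Type*} {α : ι → Type*} (H : ∀ i, Hypergraph (α i)) : Hypergraph (∀ i, α i) where
  vertexSet := {x | ∀ i, x i ∈ V(H i)}
  edgeSet := {s | ∃ i, ∃ e ∈ E(H i), ∃ a : ∀ j, α j, (∀ j, a j ∈ V(H j)) ∧
    s = {x | x i ∈ e ∧ ∀ j, j ≠ i → x j = a j}}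
  subset_vertexSet_of_mem_edgeSet' := by
    rintro s ⟨i, e, he, a, ha, rfl⟩ x ⟨hi, hx⟩ j
    by_cases h : j = i
    · subst h
      exact mem_vertexSet_of_mem_edgeSet he hi
    · rw [hx j h]
      exact ha j

/-- The discrete cube: the Cartesian product of `p` copies of the complete graph `K₂`. -/
def cube (p : ℕ) : Hypergraph (Fin p → Fin 2) :=
  piBox fun _ : Fin p => ofSimpleGraph (⊤ : SimpleGraph (Fin 2))

/-- What one cop or the robber may do in one turn: stay, or go to an adjacent vertex. -/
def Step (H : Hypergraph α) (x y : α) : Prop := y = x ∨ H.Adj x y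

/-- `H.CopsWin c r`: when the `k` cops are at `c`, the robber is at `r`, and it is the cops' turn,
the cops have a strategy that captures the robber after finitely many moves. -/
inductive CopsWin (H : Hypergraph α) {k : ℕ} : (Fin k → α) → α → Prop
  /-- The robber has already been captured. -/
  | captured {c : Fin k → α} {r : α} (i : Fin k) (h : c i = r) : CopsWin H c r
  /-- The cops make a move that captures the robber. -/
  | capture {c : Fin k → α} {r : α} (c' : Fin k → α) (hc : ∀ j, H.Step (c j) (c' j))
      (i : Fin k) (h : c' i = r) : CopsWin H c r
  /-- The cops make a move after which they win against every answer of the robber. -/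
  | move {c : Fin k → α} {r : α} (c' : Fin k → α) (hc : ∀ j, H.Step (c j) (c' j))
      (h : ∀ r', H.Step r r' → CopsWin H c' r') : CopsWin H c r

/-- `H` is `k`-cop-win: the cops can be placed on the vertices of `H` in such a way that they win
wherever the robber is then placed. Several cops may share a vertex. -/
def IsCopWin (H : Hypergraph α) (k : ℕ) : Prop :=
  ∃ c : Fin k → α, (∀ i, c i ∈ V(H)) ∧ ∀ r ∈ V(H), H.CopsWin c r

/-- The cop number: the minimum `k` such that `H` is `k`-cop-win. -/
noncomputable def copNumber (H : Hypergraph α) : ℕ := sInf {k | H.IsCopWin k}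

end Hypergraph

/-! Only adjacency matters in the game, so everything happens in 2-sections, and the 2-section of a
product is the box product of the 2-sections.

Upper bound (`IsCopWin.boxProd`): let `k` cops win on a connected `G`, and let one cop on a
connected `H` always catch a robber who never passes. Then `k + 1` cops win on `G □ H`. Some `k` of
them play on the projection to `G` until one shares its first coordinate with the robber. This
shadow copies every move in `G` and answers every move in `H` by its guarding strategy, so the
robber can make only boundedly many moves in `H`. Once these stop, the other `k` cops enter his copy
of `G` and win there. One cop guards a hypertree, a complete graph and also `K₂ □ K₂`, so each pair
of factors `K₂` costs a single cop.

Lower bound (`HasSpreadNeighbors`): if every vertex has `m` neighbours of which no other vertex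
dominates more than two, the robber always has a safe move against fewer than `m / 2` cops. Such `m`
add up in products (`HasSpreadNeighbors.boxProd`); `K₂` contributes 1, every other factor in the
theorem 2. `copNumber_eq` joins the two bounds. -/

open scoped Hypergraph

/-! ### The game on graphs -/

namespace SimpleGraph

variable {V W κ : Type*}

/-- What a cop or the robber may do in one turn: stay, or move along an edge. -/
def Step (G : SimpleGraph V) (x y : V) : Prop := y = x ∨ G.Adj x y

lemma Step.refl (G : SimpleGraph V) (x : V) : G.Step x x := Or.inl rfl

/-- The cops, placed at `c` and about to move, catch the robber at `r` in finitely many moves. -/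
inductive CopsWin (G : SimpleGraph V) : (κ → V) → V → Prop
  | capture {c : κ → V} {r : V} (c' : κ → V) (hc : ∀ j, G.Step (c j) (c' j)) (i : κ)
      (h : c' i = r) : CopsWin G c r
  | move {c : κ → V} {r : V} (c' : κ → V) (hc : ∀ j, G.Step (c j) (c' j))
      (h : ∀ r', G.Step r r' → CopsWin G c' r') : CopsWin G c r

/-- A team of cops indexed by `κ` can be placed so that it wins wherever the robber starts. -/
def IsCopWin (G : SimpleGraph V) (κ : Type*) : Prop := ∃ c : κ → V, ∀ r, G.CopsWin c r

/-- A single cop at `a`, about to see the robber move from `h`, catches the robber provided that the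
robber never passes. -/
inductive Guards (H : SimpleGraph W) : W → W → Prop
  | intro {a h : W} (answer : W → W) (step : ∀ h', H.Adj h h' → H.Step a (answer h'))
      (next : ∀ h', H.Adj h h' → answer h' ≠ h' → Guards H (answer h') h') : Guards H a h

lemma Guards.of_exists {H : SimpleGraph W} {a h : W}
    (next : ∀ h', H.Adj h h' → ∃ a', H.Step a a' ∧ (a' ≠ h' → H.Guards a' h')) :
    H.Guards a h := by
  choose! f hf using next
  exact .intro f (fun h' hh' => (hf h' hh').1) fun h' hh' => (hf h' hh').2

/-- Every vertex has `m` neighbours such that no other vertex dominates more than two of them. -/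
def HasSpreadNeighbors (G : SimpleGraph V) (m : ℕ) : Prop :=
  ∀ r, ∃ N : Finset V, N.card = m ∧ (∀ v ∈ N, G.Adj r v) ∧
    ∀ c, c ≠ r → ∀ S ⊆ N, (∀ v ∈ S, G.Step c v) → S.card ≤ 2

section Transfer

lemma Iso.step_iff {G : SimpleGraph V} {H : SimpleGraph W} (e : G ≃g H) {x y : V} :
    H.Step (e x) (e y) ↔ G.Step x y := by
  simp only [Step, e.injective.eq_iff, e.map_adj_iff]

lemma CopsWin.map_iso {G : SimpleGraph V} {H : SimpleGraph W} (e : G ≃g H) {c : κ → V} {r : V}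
    (h : G.CopsWin c r) : H.CopsWin (fun i => e (c i)) (e r) := by
  induction h with
  | capture c' hc i h => exact .capture (fun i => e (c' i)) (fun j => e.step_iff.2 (hc j)) i (by rw [h])
  | move c' hc h ih =>
    refine .move (fun i => e (c' i)) (fun j => e.step_iff.2 (hc j)) fun r' hr' => ?_
    obtain ⟨s, rfl⟩ := e.surjective r'
    exact ih s (e.step_iff.1 hr')

lemma IsCopWin.of_iso {G : SimpleGraph V} {H : SimpleGraph W} (e : G ≃g H)
    (h : G.IsCopWin κ) : H.IsCopWin κ := by
  obtain ⟨c, hc⟩ := h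
  refine ⟨fun i => e (c i), fun r => ?_⟩
  obtain ⟨s, rfl⟩ := e.surjective r
  exact (hc s).map_iso e

lemma HasSpreadNeighbors.of_iso {G : SimpleGraph V} {H : SimpleGraph W} {m : ℕ} (e : G ≃g H)
    (h : G.HasSpreadNeighbors m) : H.HasSpreadNeighbors m := by
  intro r
  obtain ⟨r, rfl⟩ := e.surjective r
  obtain ⟨N, hN, hadj, hdom⟩ := h r
  refine ⟨N.map e.toEquiv.toEmbedding, by simpa using hN, ?_, ?_⟩
  · intro v hv
    obtain ⟨w, hw, rfl⟩ := Finset.mem_map.1 hv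
    exact e.map_adj_iff.2 (hadj w hw)
  · intro c hc S hS hstep
    obtain ⟨c, rfl⟩ := e.surjective c
    obtain ⟨S, hSN, rfl⟩ := Finset.subset_map_iff.1 hS
    rw [Finset.card_map]
    refine hdom c (fun h => hc (by rw [h])) S hSN fun v hv => ?_
    exact e.step_iff.1 (hstep _ (Finset.mem_map_of_mem _ hv))

/-- Additional cops do no harm. -/
lemma CopsWin.of_comp {G : SimpleGraph V} {κ' : Type*} {f : κ' → κ} (hf : f.Injective)
    {c₀ : κ' → V} {r : V} (h : G.CopsWin c₀ r) {c : κ → V} (hc₀ : c ∘ f = c₀) :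
    G.CopsWin c r := by
  induction h generalizing c with
  | capture c' hc i h =>
    subst hc₀
    refine .capture (Function.extend f c' c) (fun j => ?_) (f i) (by rw [hf.extend_apply, h])
    by_cases hj : ∃ i, f i = j
    · obtain ⟨i, rfl⟩ := hj
      rw [hf.extend_apply]
      exact hc i
    · rw [Function.extend_apply' _ _ _ hj]
      exact .refl _ _
  | move c' hc h ih =>
    subst hc₀
    refine .move (Function.extend f c' c) (fun j => ?_) fun r' hr' =>
      ih r' hr' (by ext i; simp [hf.extend_apply])
    by_cases hj : ∃ i, f i = j
    · obtain ⟨i, rfl⟩ := hj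
      rw [hf.extend_apply]
      exact hc i
    · rw [Function.extend_apply' _ _ _ hj]
      exact .refl _ _

lemma IsCopWin.reindex {G : SimpleGraph V} {κ' : Type*} (e : κ' ≃ κ)
    (h : G.IsCopWin κ') : G.IsCopWin κ := by
  obtain ⟨c, hc⟩ := h
  exact ⟨c ∘ e.symm, fun r => (hc r).of_comp e.injective (by ext; simp)⟩

lemma IsCopWin.fin_succ {G : SimpleGraph V} {k : ℕ} (h : G.IsCopWin (Option (Fin k))) :
    G.IsCopWin (Fin (k + 1)) := h.reindex (finSuccEquiv k).symm

end Transfer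

section Connected

lemma Connected.exists_step_dist_le {G : SimpleGraph V} (hG : G.Connected) {x y : V} {n : ℕ}
    (h : G.dist x y ≤ n + 1) : ∃ z, G.Step x z ∧ G.dist z y ≤ n := by
  obtain ⟨w, hw⟩ := hG.exists_walk_length_eq_dist x y
  cases w with
  | nil => exact ⟨x, .refl _ _, by simp⟩
  | cons hadj w =>
    refine ⟨_, Or.inr hadj, (dist_le w).trans ?_⟩
    rw [Walk.length_cons] at hw
    omega

/-- Before playing, the cops walk to their winning placement while ignoring the robber. Hence phases
of a strategy can be chained from arbitrary positions. -/
lemma IsCopWin.copsWin [Finite κ] {G : SimpleGraph V} (h : G.IsCopWin κ) (hG : G.Connected)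
    (c : κ → V) (r : V) : G.CopsWin c r := by
  obtain ⟨c₀, hc₀⟩ := h
  have key : ∀ (n : ℕ) (c : κ → V) (r : V), (∀ i, G.dist (c i) (c₀ i) ≤ n) → G.CopsWin c r := by
    intro n
    induction n with
    | zero =>
      intro c r hc
      obtain rfl : c = c₀ := by
        ext i
        exact hG.dist_eq_zero_iff.1 (Nat.le_zero.1 (hc i))
      exact hc₀ r
    | succ n ih =>
      intro c r hc
      choose c' hstep hdist using fun i => hG.exists_step_dist_le (hc i)
      exact .move c' hstep fun r' _ => ih c' r' hdist
  obtain ⟨n, hn⟩ := (Set.finite_range fun i => G.dist (c i) (c₀ i)).bddAbove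
  exact key n c r fun i => hn ⟨i, rfl⟩

lemma CopsWin.exists_step_guards {G : SimpleGraph V} [Unique κ] {c : κ → V} {r : V}
    (h : G.CopsWin c r) : ∃ a, G.Step (c default) a ∧ (a ≠ r → G.Guards a r) := by
  induction h with
  | capture c' hc i h =>
    exact ⟨c' default, hc _, fun hne => absurd (by rw [← h, Unique.eq_default i]) hne⟩
  | move c' hc h ih => exact ⟨c' default, hc _, fun _ => .of_exists fun r' hr' => ih r' (Or.inr hr')⟩

/-- Forbidding the robber to pass only weakens him, so a winning cop also guards. -/
lemma IsCopWin.guards {G : SimpleGraph V} (h : G.IsCopWin Unit) (hG : G.Connected) (a r : V) :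
    G.Guards a r :=
  .of_exists fun r' _ => (h.copsWin hG (fun _ => a) r').exists_step_guards

end Connected

/-! ### Bounds for box products -/

section Product

variable {G : SimpleGraph V} {H : SimpleGraph W}

lemma boxProd_step_left {x y : V} (b : W) (h : G.Step x y) : (G □ H).Step (x, b) (y, b) :=
  h.imp (fun h => by rw [h]) boxProd_adj_left.2

lemma boxProd_step_right {x y : W} (a : V) (h : H.Step x y) : (G □ H).Step (a, x) (a, y) :=
  h.imp (fun h => by rw [h]) boxProd_adj_right.2

lemma boxProd_step_cases {x y : V} {a b : W} (h : (G □ H).Step (x, a) (y, b)) :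
    (G.Step x y ∧ b = a) ∨ (H.Adj a b ∧ y = x) := by
  rcases h with h | h | h
  · rw [Prod.mk.injEq] at h
    exact Or.inl ⟨Or.inl h.1, h.2⟩
  · exact Or.inl ⟨Or.inr h.1, h.2.symm⟩
  · exact Or.inr ⟨h.1, h.2.symm⟩

/-- If one cop has the same first coordinate as the robber and guards the second coordinate, then
the other cops can win in the first coordinate. -/
lemma Guards.copsWin_boxProd [Finite κ] (hG : G.Connected) (hH : H.Connected) (hk : G.IsCopWin κ)
    {a h : W} (hg : H.Guards a h) :
    ∀ (g : V) (c : κ → V × W) (r' : V × W), (G □ H).Step (g, h) r' →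
      (G □ H).CopsWin (fun o : Option κ => o.elim (g, a) c) r' := by
  -- Each move of the robber in `H` consumes one step of the guarding game, so only play within a
  -- single copy `G × {h}` remains to be treated.
  induction hg with
  | @intro a h answer step _ ih =>
    -- The answer to a move of the robber in the second coordinate.
    have jump : ∀ (g : V) (c : κ → V × W) (h' : W), H.Adj h h' →
        (G □ H).CopsWin (fun o : Option κ => o.elim (g, a) c) (g, h') := by
      intro g c h' hh'
      have hstep : ∀ o : Option κ, (G □ H).Step (o.elim (g, a) c) (o.elim (g, answer h') c) := by
        rintro (_ | i)
        · exact boxProd_step_right g (step h' hh')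
        · exact .refl _ _
      by_cases hne : answer h' = h'
      · exact .capture _ hstep none (by simp [hne])
      · exact .move _ hstep fun r' hr' => ih h' hh' hne g c r' hr'
    -- With the other cops inside `G × {h}`, they follow their strategy on `G`. The guard is one
    -- move behind the robber in `G`, hence the separate `g₀`.
    have aligned : ∀ (cG : κ → V) (g : V), G.CopsWin cG g → ∀ g₀, G.Step g₀ g →
        (G □ H).CopsWin (fun o : Option κ => o.elim (g₀, a) fun i => (cG i, h)) (g, h) := by
      intro cG g hwin
      induction hwin with
      | @capture cG g c' hc i hi =>
        intro g₀ hg₀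
        refine .capture (fun o : Option κ => o.elim (g, a) fun i => (c' i, h)) ?_ (some i)
          (by simp [hi])
        rintro (_ | i)
        · exact boxProd_step_left a hg₀
        · exact boxProd_step_left h (hc i)
      | @move cG g c' hc _ ihG =>
        intro g₀ hg₀
        refine .move (fun o : Option κ => o.elim (g, a) fun i => (c' i, h)) ?_ ?_
        · rintro (_ | i)
          · exact boxProd_step_left a hg₀
          · exact boxProd_step_left h (hc i)
        · rintro ⟨g', h'⟩ hr
          rcases boxProd_step_cases hr with ⟨hg, rfl⟩ | ⟨hh, rfl⟩
          · exact ihG g' hg g hg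
          · exact jump _ _ _ hh
    -- The other cops bring their second coordinates to `h`, `n` bounding the distance left.
    have align : ∀ (n : ℕ) (c : κ → V × W), (∀ i, H.dist (c i).2 h ≤ n) →
        ∀ g g₀, G.Step g₀ g →
        (G □ H).CopsWin (fun o : Option κ => o.elim (g₀, a) c) (g, h) := by
      intro n
      induction n with
      | zero =>
        intro c hc g g₀ hg₀
        have hch : c = fun i => ((c i).1, h) := by
          ext i
          · rfl
          · exact hH.dist_eq_zero_iff.1 (Nat.le_zero.1 (hc i))
        rw [hch]
        exact aligned _ _ (hk.copsWin hG _ g) g₀ hg₀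
      | succ n ihn =>
        intro c hc g g₀ hg₀
        choose c' hstep hdist using fun i => hH.exists_step_dist_le (hc i)
        refine .move (fun o : Option κ => o.elim (g, a) fun i => ((c i).1, c' i)) ?_ ?_
        · rintro (_ | i)
          · exact boxProd_step_left a hg₀
          · exact boxProd_step_right (c i).1 (hstep i)
        · rintro ⟨g', h'⟩ hr
          rcases boxProd_step_cases hr with ⟨hg, rfl⟩ | ⟨hh, rfl⟩
          · exact ihn _ hdist g' g hg
          · exact jump _ _ _ hh
    rintro g c ⟨g', h'⟩ hr
    rcases boxProd_step_cases hr with ⟨hg, rfl⟩ | ⟨hh, rfl⟩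
    · obtain ⟨n, hn⟩ := (Set.finite_range fun i => H.dist (c i).2 h').bddAbove
      exact align n c (fun i => hn ⟨i, rfl⟩) g' g hg
    · exact jump _ _ _ hh

/-- One more cop is enough for an additional factor in which a single cop guards the robber. -/
theorem IsCopWin.boxProd [Finite κ] (hG : G.Connected) (hH : H.Connected) (hk : G.IsCopWin κ)
    (hg : ∀ a h, H.Guards a h) : (G □ H).IsCopWin (Option κ) := by
  classical
  -- Whichever cop becomes the shadow trades roles with the spare cop `none`.
  have shadow : ∀ (c : Option κ → V × W) (g : V) (h : W) (r' : V × W) (i : κ),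
      (c (some i)).1 = g → (G □ H).Step (g, h) r' → (G □ H).CopsWin c r' := by
    intro c g h r' i hi hr
    refine ((hg (c (some i)).2 h).copsWin_boxProd hG hH hk g
      (fun j => c (Equiv.swap none (some i) (some j))) r' hr).of_comp
      (Equiv.swap none (some i)).injective ?_
    ext1 o
    rcases o with _ | j
    · simp [← hi]
    · simp
  -- In the projection to `G`, a move of the robber in `H` counts as a pass, and a capture means
  -- that a shadow has been obtained.
  have chase : ∀ (cG : κ → V) (g : V), G.CopsWin cG g → ∀ (c : Option κ → V × W) (h : W),
      (∀ i, (c (some i)).1 = cG i) → (G □ H).CopsWin c (g, h) := by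
    intro cG g hwin
    have hstep : ∀ (c : Option κ → V × W) (cG c' : κ → V), (∀ i, (c (some i)).1 = cG i) →
        (∀ i, G.Step (cG i) (c' i)) → ∀ o : Option κ,
        (G □ H).Step (c o) (o.elim (c none) fun i => (c' i, (c (some i)).2)) := by
      rintro c cG c' hc hc' (_ | i)
      · exact .refl _ _
      · exact boxProd_step_left _ (by rw [hc i]; exact hc' i)
    induction hwin with
    | capture c' hc' i hi =>
      intro c h hc
      exact .move _ (hstep c _ c' hc hc') fun r' hr => shadow _ _ h r' i hi hr
    | move c' hc' _ ih =>
      intro c h hc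
      refine .move _ (hstep c _ c' hc hc') ?_
      rintro ⟨g', h'⟩ hr
      refine ih g' ?_ _ _ fun i => rfl
      rcases boxProd_step_cases hr with ⟨hg, -⟩ | ⟨-, rfl⟩
      · exact hg
      · exact .refl _ _
  obtain ⟨x⟩ := (hG.boxProd hH).nonempty
  refine ⟨fun _ => x, fun r => ?_⟩
  exact chase _ r.1 (hk.copsWin hG (fun _ => x.1) r.1) _ r.2 fun _ => rfl

/-- Take the chosen neighbours in both directions. A vertex sharing one coordinate with `(g, h)`
dominates only neighbours in the direction of the other coordinate, so that factor's bound applies;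
a vertex `(a, b)` sharing none dominates at most `(a, h)` and `(g, b)`. -/
lemma HasSpreadNeighbors.boxProd {m n : ℕ} (hG : G.HasSpreadNeighbors m)
    (hH : H.HasSpreadNeighbors n) : (G □ H).HasSpreadNeighbors (m + n) := by
  classical
  rintro ⟨g, h⟩
  obtain ⟨M, hM, hMadj, hMdom⟩ := hG g
  obtain ⟨N, hN, hNadj, hNdom⟩ := hH h
  let l : V ↪ V × W := ⟨fun v => (v, h), fun _ _ e => congrArg Prod.fst e⟩
  let r : W ↪ V × W := ⟨fun w => (g, w), fun _ _ e => congrArg Prod.snd e⟩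
  refine ⟨M.map l ∪ N.map r, ?_, ?_, ?_⟩
  · rw [Finset.card_union_of_disjoint, Finset.card_map, Finset.card_map, hM, hN]
    rw [Finset.disjoint_left]
    rintro x hx hx'
    obtain ⟨v, hv, rfl⟩ := Finset.mem_map.1 hx
    obtain ⟨w, hw, e⟩ := Finset.mem_map.1 hx'
    exact (hMadj v hv).ne (congrArg Prod.fst e)
  · intro x hx
    rcases Finset.mem_union.1 hx with hx | hx
    · obtain ⟨v, hv, rfl⟩ := Finset.mem_map.1 hx
      exact boxProd_adj_left.2 (hMadj v hv)
    · obtain ⟨w, hw, rfl⟩ := Finset.mem_map.1 hx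
      exact boxProd_adj_right.2 (hNadj w hw)
  · rintro ⟨a, b⟩ hne S hS hstep
    by_cases hb : b = h
    · subst hb
      have ha : a ≠ g := fun e => hne (by rw [e])
      have hSM : S ⊆ M.map l := by
        intro x hx
        rcases Finset.mem_union.1 (hS hx) with hx' | hx'
        · exact hx'
        · obtain ⟨w, hw, rfl⟩ := Finset.mem_map.1 hx'
          rcases boxProd_step_cases (hstep _ hx) with ⟨-, e⟩ | ⟨-, e⟩
          · exact absurd e (hNadj w hw).ne'
          · exact absurd e.symm ha
      obtain ⟨S, hS', rfl⟩ := Finset.subset_map_iff.1 hSM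
      rw [Finset.card_map]
      refine hMdom a ha S hS' fun v hv => ?_
      rcases boxProd_step_cases (hstep _ (Finset.mem_map_of_mem l hv)) with ⟨e, -⟩ | ⟨e, -⟩
      · exact e
      · exact absurd e (H.irrefl)
    · by_cases ha : a = g
      · subst ha
        have hSN : S ⊆ N.map r := by
          intro x hx
          rcases Finset.mem_union.1 (hS hx) with hx' | hx'
          · obtain ⟨v, hv, rfl⟩ := Finset.mem_map.1 hx'
            rcases boxProd_step_cases (hstep _ hx) with ⟨-, e⟩ | ⟨-, e⟩
            · exact absurd e.symm hb
            · exact absurd e (hMadj v hv).ne'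
          · exact hx'
        obtain ⟨S, hS', rfl⟩ := Finset.subset_map_iff.1 hSN
        rw [Finset.card_map]
        refine hNdom b hb S hS' fun w hw => ?_
        rcases boxProd_step_cases (hstep _ (Finset.mem_map_of_mem r hw)) with ⟨-, e⟩ | ⟨e, -⟩
        · exact Or.inl e
        · exact Or.inr e
      · refine (Finset.card_le_card (t := {(a, h), (g, b)}) fun x hx => ?_).trans
          Finset.card_le_two
        rcases Finset.mem_union.1 (hS hx) with hx' | hx'
        · obtain ⟨v, hv, rfl⟩ := Finset.mem_map.1 hx'
          rcases boxProd_step_cases (hstep _ hx) with ⟨-, e⟩ | ⟨-, e⟩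
          · exact absurd e.symm hb
          · exact Finset.mem_insert.2 (Or.inl (congrArg (·, h) e))
        · obtain ⟨w, hw, rfl⟩ := Finset.mem_map.1 hx'
          rcases boxProd_step_cases (hstep _ hx) with ⟨-, e⟩ | ⟨-, e⟩
          · exact Finset.mem_insert.2 (Or.inr (Finset.mem_singleton.2 (congrArg (g, ·) e)))
          · exact absurd e.symm ha

/-- Fewer than `m / 2` cops never catch the robber. -/
theorem HasSpreadNeighbors.not_isCopWin [Fintype κ] [Nonempty V] {m : ℕ}
    (hG : G.HasSpreadNeighbors m) (hm : 2 * Fintype.card κ < m) : ¬ G.IsCopWin κ := by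
  classical
  have escape : ∀ (c : κ → V) (r : V), (∀ i, c i ≠ r) →
      ∃ v, G.Adj r v ∧ ∀ i, ¬ G.Step (c i) v := by
    intro c r hc
    obtain ⟨N, hN, hadj, hdom⟩ := hG r
    by_contra! hcon
    have hsub : N ⊆ Finset.univ.biUnion fun i => N.filter fun v => G.Step (c i) v := by
      intro v hv
      obtain ⟨i, hi⟩ := hcon v (hadj v hv)
      exact Finset.mem_biUnion.2 ⟨i, Finset.mem_univ i, Finset.mem_filter.2 ⟨hv, hi⟩⟩
    have hle := (Finset.card_le_card hsub).trans (Finset.card_biUnion_le_card_mul _ _ 2 fun i _ =>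
      hdom (c i) (hc i) _ (Finset.filter_subset _ _) fun v hv => (Finset.mem_filter.1 hv).2)
    rw [hN, Finset.card_univ] at hle
    omega
  -- The robber's invariant on the cops' turn: no cop can reach him in one step.
  have lose : ∀ (c : κ → V) (r : V), G.CopsWin c r → ¬ ∀ i, ¬ G.Step (c i) r := by
    intro c r hwin
    induction hwin with
    | capture c' hc i hi => exact fun hsafe => hsafe i (hi ▸ hc i)
    | @move c r c' hc _ ih =>
      intro hsafe
      obtain ⟨v, hv, hv'⟩ := escape c' r fun i hi => hsafe i (hi ▸ hc i)
      exact ih v (Or.inr hv) hv'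
  rintro ⟨c, hc⟩
  -- The cops cannot occupy every vertex, since a vertex has `m` neighbours. Escaping from a free
  -- vertex then yields a safe start.
  obtain ⟨r, hr⟩ : ∃ r, ∀ i, c i ≠ r := by
    by_contra! hcon
    obtain ⟨N, hN, -⟩ := hG (Classical.arbitrary V)
    have hle := (Finset.card_le_card (s := N) (t := Finset.univ.image c) fun v _ => by
      obtain ⟨i, hi⟩ := hcon v
      exact Finset.mem_image.2 ⟨i, Finset.mem_univ i, hi⟩).trans Finset.card_image_le
    rw [hN, Finset.card_univ] at hle
    omega
  obtain ⟨v, -, hv⟩ := escape c r hr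
  exact lose c v (hc v) hv

end Product

end SimpleGraph

/-! ### One cop on a hypertree -/

namespace SimpleGraph

variable {V : Type*}

/-- A walk in an induced subgraph is a walk in the graph. -/
lemma Walk.exists_of_induce {T : SimpleGraph V} {s : Set V} {x y : s}
    (w : (T.induce s).Walk x y) : ∃ w' : T.Walk x y, ∀ z ∈ w'.support, z ∈ s := by
  induction w with
  | nil => exact ⟨.nil, by simp⟩
  | @cons u v _ h _ ih =>
    obtain ⟨w', hw'⟩ := ih
    have hadj : T.Adj u v := h
    exact ⟨.cons hadj w', List.forall_mem_cons.2 ⟨u.2, hw'⟩⟩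

/-- One cop wins on a graph with a spanning tree `T` such that whoever moves past a vertex `c` of
`T` is caught from there: the cop walks down the tree towards the robber. -/
theorem IsTree.isCopWin [Finite V] {T G : SimpleGraph V} (hT : T.IsTree) (hTG : T ≤ G)
    (hpass : ∀ r r', G.Adj r r' → ∀ c, G.Step c r' ∨ ∃ w : T.Walk r r', c ∉ w.support) :
    G.IsCopWin Unit := by
  classical
  have := Fintype.ofFinite V
  obtain ⟨c₀⟩ := hT.connected.nonempty
  have unique : ∀ {u v : V} {p q : T.Walk u v}, p.IsPath → q.IsPath → p = q := fun hp hq =>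
    (hT.existsUnique_path _ _).unique hp hq
  -- Invariant: `c` separates the root `c₀` from the robber in `T`. The depth of `c` grows with each
  -- move, and `m` bounds the growth still possible.
  have key : ∀ (m : ℕ) (c r : V) (q : T.Walk c₀ c), q.IsPath → Fintype.card V ≤ q.length + m →
      (∀ w : T.Walk c₀ r, c ∈ w.support) → G.CopsWin (fun _ : Unit => c) r := by
    intro m
    induction m with
    | zero => exact fun c r q hq hm => absurd hq.length_lt (not_lt.2 hm)
    | succ m ih =>
      intro c r q hq hm hsep
      by_cases hcr : c = r
      · exact .capture (fun _ => c) (fun _ => .refl _ _) () hcr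
      obtain ⟨p, hp, -⟩ := hT.existsUnique_path c₀ r
      obtain rfl : q = p.takeUntil c (hsep p) := unique hq (hp.takeUntil _)
      obtain ⟨s, hadj, t, hst⟩ : ∃ (s : V) (hadj : T.Adj c s) (t : T.Walk s r),
          p.dropUntil c (hsep p) = .cons hadj t := by
        cases h : p.dropUntil c (hsep p) with
        | nil => exact absurd rfl hcr
        | cons hadj t => exact ⟨_, hadj, t, rfl⟩
      have hp_eq : ((p.takeUntil c (hsep p)).concat hadj).append t = p := by
        rw [Walk.concat_append, ← hst, Walk.take_spec]
      have hs : s ∈ p.support := by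
        rw [← hp_eq, Walk.mem_support_append_iff]
        exact Or.inr t.start_mem_support
      have hpath : ((p.takeUntil c (hsep p)).concat hadj).IsPath := by
        rw [← hp_eq] at hp
        exact hp.of_append_left
      have hsep' : ∀ w : T.Walk c₀ r, s ∈ w.support := fun w =>
        w.support_bypass_subset_support (unique hp w.bypass_isPath ▸ hs)
      have next : ∀ r', (∀ w : T.Walk c₀ r', s ∈ w.support) →
          G.CopsWin (fun _ : Unit => s) r' := fun r' h =>
        ih s r' _ hpath (by rw [Walk.length_concat]; omega) h
      refine .move (fun _ => s) (fun _ => Or.inr (hTG hadj)) fun r' hr' => ?_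
      rcases hr' with rfl | hr'
      · exact next _ hsep'
      -- Either the robber's move brings him within reach of `s`, or a tree walk from `r` to `r'`
      -- avoids `s`, and then `s` still separates him from the root.
      · rcases hpass r r' hr' s with hstep | ⟨w, hw⟩
        · exact .capture (fun _ => r') (fun _ => hstep) () rfl
        · refine next r' fun w' => ?_
          have := hsep' (w'.append w.reverse)
          rw [Walk.mem_support_append_iff, Walk.support_reverse, List.mem_reverse] at this
          exact this.resolve_right hw
  exact ⟨fun _ => c₀, fun r => key _ c₀ r .nil .nil (Nat.le_add_left _ _)
    fun w => w.start_mem_support⟩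

end SimpleGraph

namespace Hypergraph

variable {α : Type*} {H : Hypergraph α}

/-- If the hyperedge containing a robber move contains the cop, the cop captures; otherwise its
subtree provides a walk around the cop. -/
lemma IsHypertree.isCopWin (hfin : V(H).Finite) (h : H.IsHypertree) :
    H.twoSection.IsCopWin Unit := by
  have := hfin.to_subtype
  obtain ⟨hconn, T, hT, hsub⟩ := h
  have hwalk : ∀ e ∈ E(H), ∀ u v : V(H), (u : α) ∈ e → (v : α) ∈ e →
      ∃ w : T.Walk u v, ∀ z ∈ w.support, (z : α) ∈ e := by
    intro e he u v hu hv
    obtain ⟨w⟩ := (hsub e he).connected.preconnected ⟨u, hu⟩ ⟨v, hv⟩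
    exact w.exists_of_induce
  refine hT.isCopWin (fun x y hxy => ?_) fun r r' hrr' c => ?_
  -- If no hyperedge contained both ends of a tree edge, deleting that edge would leave every
  -- hyperedge's subtree intact, and connectedness of the 2-section would contradict its being a
  -- bridge.
  · by_contra hcon
    have hbridge := SimpleGraph.isBridge_iff.1
      (SimpleGraph.isAcyclic_iff_forall_adj_isBridge.1 hT.isAcyclic hxy)
    have hreach : ∀ u v, H.twoSection.Adj u v → (T.deleteEdges {s(x, y)}).Reachable u v := by
      rintro u v ⟨-, e, he, hu, hv⟩
      obtain ⟨w, hw⟩ := hwalk e he u v hu hv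
      refine SimpleGraph.reachable_deleteEdges_iff_exists_walk.2 ⟨w, fun hmem => hcon ?_⟩
      exact ⟨hxy.ne, e, he, hw _ (w.fst_mem_support_of_mem_edges hmem),
        hw _ (w.snd_mem_support_of_mem_edges hmem)⟩
    have hwalk' : ∀ {u v} (w : H.twoSection.Walk u v),
        (T.deleteEdges {s(x, y)}).Reachable u v := by
      intro u v w
      induction w with
      | nil => rfl
      | cons h _ ih => exact (hreach _ _ h).trans ih
    obtain ⟨w⟩ := hconn.preconnected x y
    exact hbridge (hwalk' w)
  · obtain ⟨-, e, he, hr, hr'⟩ := hrr'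
    by_cases hc : (c : α) ∈ e
    · by_cases hcr : c = r'
      · exact Or.inl (Or.inl hcr.symm)
      · exact Or.inl (Or.inr ⟨hcr, e, he, hc, hr'⟩)
    · obtain ⟨w, hw⟩ := hwalk e he r r' hr hr'
      exact Or.inr ⟨w, fun h => hc (hw c h)⟩

end Hypergraph

/-! ### Small factors -/

namespace SimpleGraph

variable {V W U : Type*}

/-- Isomorphic factors give isomorphic box products. -/
def boxProdCongrLeft {G : SimpleGraph V} {G' : SimpleGraph W} (e : G ≃g G') (H : SimpleGraph U) :
    boxProd G H ≃g boxProd G' H where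
  toEquiv := e.toEquiv.prodCongr (Equiv.refl U)
  map_rel_iff' := by
    intro x y
    simp [boxProd_adj, e.map_adj_iff]

/-- A factor with a single vertex can be dropped. -/
def boxProdUnique (G : SimpleGraph V) (H : SimpleGraph U) [Unique U] :
    boxProd G H ≃g G where
  toEquiv := Equiv.prodUnique V U
  map_rel_iff' := by
    intro x y
    have : x.2 = y.2 := Subsingleton.elim _ _
    simp [boxProd_adj, this]

/-- With at most two chosen neighbours the domination condition is automatic. -/
lemma HasSpreadNeighbors.of_le_two {G : SimpleGraph V} {m : ℕ} (hm : m ≤ 2)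
    (h : ∀ r, ∃ N : Finset V, N.card = m ∧ ∀ v ∈ N, G.Adj r v) : G.HasSpreadNeighbors m := by
  intro r
  obtain ⟨N, hN, hadj⟩ := h r
  exact ⟨N, hN, hadj, fun c _ S hS _ => (Finset.card_le_card hS).trans (hN.trans_le hm)⟩

lemma hasSpreadNeighbors_of_subsingleton [Subsingleton V] (G : SimpleGraph V) :
    G.HasSpreadNeighbors 0 := .of_le_two (by simp) fun _ => ⟨∅, rfl, by simp⟩

lemma isCopWin_of_forall_ne_adj {G : SimpleGraph V} [Nonempty V] (h : ∀ x y, x ≠ y → G.Adj x y) :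
    G.IsCopWin Unit := by
  refine ⟨fun _ => Classical.arbitrary V, fun r => .capture (fun _ => r) (fun _ => ?_) () rfl⟩
  by_cases hr : r = Classical.arbitrary V
  · exact Or.inl hr
  · exact Or.inr (h _ _ (Ne.symm hr))

lemma connected_of_forall_ne_adj {G : SimpleGraph V} [Nonempty V] (h : ∀ x y, x ≠ y → G.Adj x y) :
    G.Connected := by
  refine ⟨fun x y => ?_⟩
  by_cases hxy : x = y
  · rw [hxy]
  · exact (h x y hxy).reachable

/-- On a four-cycle, a single cop guards the robber. -/
lemma guards_boxProd_of_forall_eq_or {K : SimpleGraph V} (hadj : ∀ x y, x ≠ y → K.Adj x y)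
    (htwo : ∀ x y z : V, x ≠ y → z = x ∨ z = y) (a h : V × V) : (K □ K).Guards a h := by
  -- Both neighbours of the vertex opposite the cop are adjacent to the cop, so a robber forced to
  -- move from there is caught.
  have opposite : ∀ a h : V × V, a.1 ≠ h.1 → a.2 ≠ h.2 → (K □ K).Guards a h := by
    rintro ⟨a, b⟩ ⟨g, h⟩ hag hbh
    refine .of_exists ?_
    rintro ⟨g', h'⟩ (⟨h₁, h₂⟩ | ⟨h₁, h₂⟩)
    · obtain rfl : g' = a := (htwo a g g' hag).resolve_right h₁.ne'
      exact ⟨_, Or.inr (Or.inr ⟨hadj _ _ fun e => hbh (e.trans h₂.symm), rfl⟩), fun e => absurd rfl e⟩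
    · obtain rfl : h' = b := (htwo b h h' hbh).resolve_right h₁.ne'
      exact ⟨_, Or.inr (Or.inl ⟨hadj _ _ fun e => hag (e.trans h₂.symm), rfl⟩), fun e => absurd rfl e⟩
  refine .of_exists fun h' hh' => ?_
  by_cases h₁ : a.1 = h'.1
  · by_cases h₂ : a.2 = h'.2
    · exact ⟨a, .refl _ _, fun e => absurd (Prod.ext h₁ h₂) e⟩
    · exact ⟨h', Or.inr (Or.inr ⟨hadj _ _ h₂, h₁⟩), fun e => absurd rfl e⟩
  · by_cases h₂ : a.2 = h'.2
    · exact ⟨h', Or.inr (Or.inl ⟨hadj _ _ h₁, h₂⟩), fun e => absurd rfl e⟩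
    · exact ⟨a, .refl _ _, fun _ => opposite a h' h₁ h₂⟩

end SimpleGraph

/-! ### From hypergraphs to their 2-sections -/

namespace Hypergraph

variable {α β : Type*}

lemma twoSection_step_iff {H : Hypergraph α} {x y : V(H)} :
    H.twoSection.Step x y ↔ H.Step x y := by
  by_cases h : y = x
  · simp [SimpleGraph.Step, Step, h]
  · simp [SimpleGraph.Step, Step, twoSection, h, Ne.symm h, Subtype.ext_iff.not.1 h]

lemma Step.mem_vertexSet {H : Hypergraph α} {x y : α} (h : H.Step x y) (hx : x ∈ V(H)) :
    y ∈ V(H) := by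
  rcases h with rfl | ⟨e, he, -, hy⟩
  · exact hx
  · exact mem_vertexSet_of_mem_edgeSet he hy

/-- Legal moves never leave the vertex set, and a position of type `captured` becomes a capture in
which all cops pass. -/
lemma isCopWin_iff {H : Hypergraph α} {k : ℕ} :
    H.IsCopWin k ↔ H.twoSection.IsCopWin (Fin k) := by
  constructor
  · have key : ∀ (c : Fin k → α) (r : α), H.CopsWin c r → ∀ (c₀ : Fin k → V(H)) (r₀ : V(H)),
        (∀ i, (c₀ i : α) = c i) → (r₀ : α) = r → H.twoSection.CopsWin c₀ r₀ := by
      intro c r hwin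
      induction hwin with
      | captured i h =>
        intro c₀ r₀ hc hr
        exact .capture c₀ (fun _ => .refl _ _) i (Subtype.ext (by rw [hc, hr, h]))
      | capture c' hc' i h =>
        intro c₀ r₀ hc hr
        have hmem : ∀ i, c' i ∈ V(H) := fun i => (hc' i).mem_vertexSet (hc i ▸ (c₀ i).2)
        refine .capture (fun i => ⟨c' i, hmem i⟩) (fun j => ?_) i (Subtype.ext (h.trans hr.symm))
        rw [twoSection_step_iff, hc]
        exact hc' j
      | move c' hc' _ ih =>
        intro c₀ r₀ hc hr
        have hmem : ∀ i, c' i ∈ V(H) := fun i => (hc' i).mem_vertexSet (hc i ▸ (c₀ i).2)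
        refine .move (fun i => ⟨c' i, hmem i⟩) (fun j => ?_) fun r' hr' => ?_
        · rw [twoSection_step_iff, hc]
          exact hc' j
        · rw [twoSection_step_iff, hr] at hr'
          exact ih r' hr' _ r' (fun _ => rfl) rfl
    rintro ⟨c, hc, hwin⟩
    exact ⟨fun i => ⟨c i, hc i⟩, fun r => key c r (hwin r r.2) _ r (fun _ => rfl) rfl⟩
  · have key : ∀ (c : Fin k → V(H)) (r : V(H)), H.twoSection.CopsWin c r →
        H.CopsWin (fun i => (c i : α)) r := by
      intro c r hwin
      induction hwin with
      | capture c' hc' i h =>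
        exact .capture _ (fun j => twoSection_step_iff.1 (hc' j)) i (congrArg Subtype.val h)
      | @move c r c' hc' _ ih =>
        exact .move _ (fun j => twoSection_step_iff.1 (hc' j)) fun r' hr' =>
          ih ⟨r', hr'.mem_vertexSet r.2⟩ (twoSection_step_iff.2 hr')
    rintro ⟨c, hwin⟩
    exact ⟨fun i => c i, fun i => (c i).2, fun r hr => key c ⟨r, hr⟩ (hwin _)⟩

lemma copNumber_eq {H : Hypergraph α} {k m : ℕ} [Nonempty V(H)]
    (hk : H.twoSection.IsCopWin (Fin k)) (hm : H.twoSection.HasSpreadNeighbors m)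
    (hkm : 2 * k ≤ m + 1) : H.copNumber = k := by
  refine le_antisymm (Nat.sInf_le (isCopWin_iff.2 hk)) (le_csInf ⟨k, isCopWin_iff.2 hk⟩ ?_)
  intro l hl
  by_contra! hlt
  exact hm.not_isCopWin (by rw [Fintype.card_fin]; omega) (isCopWin_iff.1 hl)

/-- The `2`-section of a product of two hypergraphs. -/
def twoSectionBoxIso (G : Hypergraph α) (H : Hypergraph β) :
    (G.box H).twoSection ≃g G.twoSection □ H.twoSection where
  toFun x := (⟨x.1.1, x.2.1⟩, ⟨x.1.2, x.2.2⟩)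
  invFun x := ⟨(x.1, x.2), x.1.2, x.2.2⟩
  left_inv _ := rfl
  right_inv _ := rfl
  map_rel_iff' := by
    rintro ⟨⟨a, b⟩, ha, hb⟩ ⟨⟨a', b'⟩, ha', hb'⟩
    change ((⟨a, ha⟩ : V(G)) ≠ ⟨a', ha'⟩ ∧ G.Adj a a') ∧ (⟨b, hb⟩ : V(H)) = ⟨b', hb'⟩ ∨
      ((⟨b, hb⟩ : V(H)) ≠ ⟨b', hb'⟩ ∧ H.Adj b b') ∧ (⟨a, ha⟩ : V(G)) = ⟨a', ha'⟩ ↔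
      (⟨(a, b), ha, hb⟩ : V(G.box H)) ≠ ⟨(a', b'), ha', hb'⟩ ∧ (G.box H).Adj (a, b) (a', b')
    simp only [ne_eq, Subtype.ext_iff, Prod.mk.injEq]
    constructor
    · rintro (⟨⟨hne, e, he, hx, hy⟩, rfl⟩ | ⟨⟨hne, e, he, hx, hy⟩, rfl⟩)
      · exact ⟨fun h => hne h.1, _, Or.inr ⟨e, he, b, hb, rfl⟩, ⟨hx, rfl⟩, ⟨hy, rfl⟩⟩
      · exact ⟨fun h => hne h.2, _, Or.inl ⟨a, ha, e, he, rfl⟩, ⟨rfl, hx⟩, ⟨rfl, hy⟩⟩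
    · rintro ⟨hne, s, ⟨v, hv, e, he, rfl⟩ | ⟨e, he, v, hv, rfl⟩, ⟨h₁, h₂⟩, h₃, h₄⟩
      · obtain rfl : a = v := h₁
        obtain rfl : a' = a := h₃
        exact Or.inr ⟨⟨fun h => hne ⟨rfl, h⟩, e, he, h₂, h₄⟩, rfl⟩
      · obtain rfl : b = v := h₂
        obtain rfl : b' = b := h₄
        exact Or.inl ⟨⟨fun h => hne ⟨h, rfl⟩, e, he, h₁, h₃⟩, rfl⟩

lemma piBox_adj {ι : Type*} {γ : ι → Type*} {H : ∀ i, Hypergraph (γ i)} {x y : ∀ i, γ i}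
    (hx : x ∈ V(piBox H)) :
    (piBox H).Adj x y ↔ ∃ i, (H i).Adj (x i) (y i) ∧ ∀ j, j ≠ i → x j = y j := by
  constructor
  · rintro ⟨s, ⟨i, e, he, a, ha, rfl⟩, ⟨h₁, h₂⟩, h₃, h₄⟩
    exact ⟨i, ⟨e, he, h₁, h₃⟩, fun j hj => (h₂ j hj).trans (h₄ j hj).symm⟩
  · rintro ⟨i, ⟨e, he, h₁, h₃⟩, h⟩
    exact ⟨_, ⟨i, e, he, x, hx, rfl⟩, ⟨h₁, fun _ _ => rfl⟩, h₃, fun j hj => (h j hj).symm⟩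

/-- The `2`-section of a product of `n + 1` hypergraphs. -/
def twoSectionPiBoxIso {n : ℕ} {γ : Fin (n + 1) → Type*} (H : ∀ i, Hypergraph (γ i)) :
    (piBox H).twoSection ≃g (H 0).twoSection □ (piBox fun i : Fin n => H i.succ).twoSection where
  toFun x := (⟨x.1 0, x.2 0⟩, ⟨fun i => x.1 i.succ, fun i => x.2 i.succ⟩)
  invFun x := ⟨Fin.cons x.1.1 x.2.1, Fin.cases x.1.2 x.2.2⟩
  left_inv x := Subtype.ext (Fin.cons_self_tail x.1)
  right_inv _ := rfl
  map_rel_iff' := by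
    rintro ⟨x, hx⟩ ⟨y, hy⟩
    have hx' : (fun i : Fin n => x i.succ) ∈ V(piBox fun i : Fin n => H i.succ) :=
      fun i => hx i.succ
    change ((⟨x 0, hx 0⟩ : V(H 0)) ≠ ⟨y 0, hy 0⟩ ∧ (H 0).Adj (x 0) (y 0)) ∧
        (⟨_, hx'⟩ : V(piBox fun i : Fin n => H i.succ)) = ⟨fun i => y i.succ, fun i => hy i.succ⟩ ∨
      ((⟨_, hx'⟩ : V(piBox fun i : Fin n => H i.succ)) ≠
        ⟨fun i => y i.succ, fun i => hy i.succ⟩ ∧ (piBox fun i : Fin n => H i.succ).Adj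
          (fun i => x i.succ) fun i => y i.succ) ∧ (⟨x 0, hx 0⟩ : V(H 0)) = ⟨y 0, hy 0⟩ ↔
      (⟨x, hx⟩ : V(piBox H)) ≠ ⟨y, hy⟩ ∧ (piBox H).Adj x y
    simp only [ne_eq, Subtype.ext_iff, piBox_adj hx, piBox_adj hx']
    constructor
    · rintro (⟨⟨hne, hadj⟩, h⟩ | ⟨⟨hne, i, hadj, hi⟩, h⟩)
      · refine ⟨fun e => hne (congrFun e 0), 0, hadj, fun j hj => ?_⟩
        obtain ⟨j, rfl⟩ := Fin.exists_succ_eq.2 hj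
        exact congrFun h j
      · refine ⟨fun e => hne (funext fun j => congrFun e j.succ), i.succ, hadj, fun j hj => ?_⟩
        cases j using Fin.cases with
        | zero => exact h
        | succ j => exact hi j fun e => hj (by rw [e])
    · rintro ⟨hne, i, hadj, hi⟩
      cases i using Fin.cases with
      | zero =>
        have htail : ∀ j : Fin n, x j.succ = y j.succ := fun j => hi _ (Fin.succ_ne_zero j)
        exact Or.inl ⟨⟨fun h => hne (funext (Fin.cases h htail)), hadj⟩, funext htail⟩
      | succ i =>
        have hzero : x 0 = y 0 := hi 0 (Fin.succ_ne_zero i).symm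
        exact Or.inr ⟨⟨fun h => hne (funext (Fin.cases hzero (congrFun h))), i, hadj,
          fun j hj => hi _ fun e => hj (Fin.succ_injective n e)⟩, hzero⟩

instance {γ : Fin 0 → Type*} (H : ∀ i, Hypergraph (γ i)) : Unique V(piBox H) where
  default := ⟨fun i => i.elim0, fun i => i.elim0⟩
  uniq _ := Subtype.ext (funext fun i => i.elim0)

lemma connected_twoSection_piBox {n : ℕ} {γ : Fin n → Type*} {H : ∀ i, Hypergraph (γ i)}
    (hconn : ∀ i, (H i).twoSection.Connected) : (piBox H).twoSection.Connected := by
  induction n with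
  | zero => exact SimpleGraph.connected_of_forall_ne_adj fun x y h => absurd (Subsingleton.elim x y) h
  | succ n ih =>
    exact (twoSectionPiBoxIso H).connected_iff.2 ((hconn 0).boxProd (ih fun i => hconn i.succ))

lemma isCopWin_twoSection_piBox {n : ℕ} {γ : Fin (n + 1) → Type*} {H : ∀ i, Hypergraph (γ i)}
    (hconn : ∀ i, (H i).twoSection.Connected) (hwin : ∀ i, (H i).twoSection.IsCopWin Unit) :
    (piBox H).twoSection.IsCopWin (Fin (n + 1)) := by
  induction n with
  | zero =>
    exact ((hwin 0).of_iso ((twoSectionPiBoxIso H).trans (SimpleGraph.boxProdUnique _ _)).symm).reindex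
      (Equiv.ofUnique Unit (Fin 1))
  | succ n ih =>
    refine SimpleGraph.IsCopWin.fin_succ (.of_iso
      ((twoSectionPiBoxIso H).trans (SimpleGraph.boxProdComm _ _)).symm ?_)
    exact (ih (fun i => hconn i.succ) fun i => hwin i.succ).boxProd
      (connected_twoSection_piBox fun i => hconn i.succ) (hconn 0) ((hwin 0).guards (hconn 0))

lemma hasSpreadNeighbors_twoSection_piBox {n m : ℕ} {γ : Fin n → Type*}
    {H : ∀ i, Hypergraph (γ i)} (h : ∀ i, (H i).twoSection.HasSpreadNeighbors m) :
    (piBox H).twoSection.HasSpreadNeighbors (n * m) := by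
  induction n with
  | zero => simpa using SimpleGraph.hasSpreadNeighbors_of_subsingleton (piBox H).twoSection
  | succ n ih =>
    have := ((h 0).boxProd (ih fun i => h i.succ)).of_iso (twoSectionPiBoxIso H).symm
    rwa [show (n + 1) * m = m + n * m by ring]

lemma IsHypertree.hasSpreadNeighbors {H : Hypergraph α} (hH : H.IsHypertree)
    (hrank : 3 ≤ H.antiRank) : H.twoSection.HasSpreadNeighbors 2 := by
  classical
  -- As infinite sets have `ncard` zero, this also makes every edge finite.
  have hlarge : ∀ e ∈ E(H), 2 < e.ncard := fun e he =>
    lt_of_lt_of_le hrank (Nat.sInf_le ⟨e, he, rfl⟩)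
  obtain ⟨e₀, he₀⟩ : E(H).Nonempty := by
    rw [Set.nonempty_iff_ne_empty]
    intro h
    simp [antiRank, h] at hrank
  have hnontrivial : Nontrivial V(H) := by
    obtain ⟨a, ha, b, hb, -, -, hab, -⟩ := (Set.two_lt_ncard
      (Set.finite_of_ncard_pos (by have := hlarge e₀ he₀; omega))).1 (hlarge e₀ he₀)
    exact ⟨⟨a, mem_vertexSet_of_mem_edgeSet he₀ ha⟩, ⟨b, mem_vertexSet_of_mem_edgeSet he₀ hb⟩,
      fun h => hab (congrArg Subtype.val h)⟩
  refine .of_le_two le_rfl fun r => ?_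
  obtain ⟨v, -, e, he, hr, -⟩ := SimpleGraph.Preconnected.exists_adj_of_nontrivial hH.1.preconnected r
  obtain ⟨a, b, ha, hb, hab⟩ : ∃ a b, a ∈ e \ {(r : α)} ∧ b ∈ e \ {(r : α)} ∧ a ≠ b := by
    refine (Set.one_lt_ncard_iff ((Set.finite_of_ncard_pos ?_).subset Set.sdiff_subset)).1 ?_
    · have := hlarge e he
      omega
    · rw [Set.ncard_sdiff_singleton_of_mem hr]
      have := hlarge e he
      omega
  refine ⟨{⟨a, mem_vertexSet_of_mem_edgeSet he ha.1⟩, ⟨b, mem_vertexSet_of_mem_edgeSet he hb.1⟩},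
    Finset.card_pair fun h => hab (congrArg Subtype.val h), ?_⟩
  simp only [Finset.mem_insert, Finset.mem_singleton, forall_eq_or_imp, forall_eq]
  exact ⟨⟨fun h => ha.2 (congrArg Subtype.val h).symm, e, he, hr, ha.1⟩,
    ⟨fun h => hb.2 (congrArg Subtype.val h).symm, e, he, hr, hb.1⟩⟩

/-- The edge size `r` is at least 2, and `V(H)` has at least `r` elements because an edge exists, so
any pair extends to an edge. -/
lemma IsUniformComplete.adj {H : Hypergraph α} (hH : H.IsUniformComplete) (hrank : 2 ≤ H.rank)
    {x y : V(H)} (hxy : x ≠ y) : H.twoSection.Adj x y := by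
  obtain ⟨r, hr⟩ := hH
  obtain ⟨e₀, he₀⟩ : E(H).Nonempty := by
    rw [Set.nonempty_iff_ne_empty]
    intro h
    simp [rank, h] at hrank
  have hr₂ : 2 ≤ r := by
    refine hrank.trans (csSup_le ⟨_, e₀, he₀, rfl⟩ ?_)
    rintro _ ⟨e, he, rfl⟩
    rw [Set.ncard, ((hr e).1 he).2, ENat.toNat_natCast]
  have hpair : ({(x : α), (y : α)} : Set α).encard ≤ r := by
    rw [Set.encard_pair fun h => hxy (Subtype.ext h)]
    exact_mod_cast hr₂
  obtain ⟨e, he, heV, hcard⟩ := Set.exists_superset_subset_encard_eq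
    (Set.insert_subset x.2 (Set.singleton_subset_iff.2 y.2)) hpair
    (((hr e₀).1 he₀).2 ▸ Set.encard_le_encard ((hr e₀).1 he₀).1)
  exact ⟨hxy, e, (hr e).2 ⟨heV, hcard⟩, he (Set.mem_insert _ _),
    he (Set.mem_insert_of_mem _ rfl)⟩

lemma adj_ofSimpleGraph_top {x y : V(ofSimpleGraph (⊤ : SimpleGraph (Fin 2)))} (hxy : x ≠ y) :
    (ofSimpleGraph (⊤ : SimpleGraph (Fin 2))).twoSection.Adj x y :=
  ⟨hxy, _, ⟨x, y, fun h => hxy (Subtype.ext h), rfl⟩, by simp, by simp⟩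

lemma nonempty_vertexSet_ofSimpleGraph {G : SimpleGraph α} [Nonempty α] :
    Nonempty V(ofSimpleGraph G) := ⟨⟨Classical.arbitrary α, trivial⟩⟩

lemma connected_twoSection_cube (p : ℕ) : (cube p).twoSection.Connected :=
  connected_twoSection_piBox fun _ =>
    have := nonempty_vertexSet_ofSimpleGraph (G := (⊤ : SimpleGraph (Fin 2)))
    SimpleGraph.connected_of_forall_ne_adj fun _ _ => adj_ofSimpleGraph_top

lemma hasSpreadNeighbors_twoSection_cube (p : ℕ) :
    (cube p).twoSection.HasSpreadNeighbors (p * 1) := by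
  refine hasSpreadNeighbors_twoSection_piBox fun _ => .of_le_two (by simp) fun r => ?_
  obtain ⟨s, hs⟩ := exists_ne r.1
  refine ⟨{⟨s, trivial⟩}, rfl, fun v hv => ?_⟩
  rw [Finset.mem_singleton.1 hv]
  exact adj_ofSimpleGraph_top fun h => hs (congrArg Subtype.val h).symm

/-- Two more factors `K₂` require at most one more cop. -/
lemma isCopWin_cube_boxProd {V : Type*} {X : SimpleGraph V} {k : ℕ} (hX : X.Connected)
    (hk : X.IsCopWin (Fin k)) (p : ℕ) :
    ((cube p).twoSection □ X).IsCopWin (Fin ((p + 1) / 2 + k)) := by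
  have := nonempty_vertexSet_ofSimpleGraph (G := (⊤ : SimpleGraph (Fin 2)))
  let K := (ofSimpleGraph (⊤ : SimpleGraph (Fin 2))).twoSection
  have hadj : ∀ x y, x ≠ y → K.Adj x y := fun _ _ => adj_ofSimpleGraph_top
  have hK : K.Connected := SimpleGraph.connected_of_forall_ne_adj hadj
  have succIso : ∀ p, (cube (p + 1)).twoSection ≃g K □ (cube p).twoSection :=
    fun p => twoSectionPiBoxIso _
  have hcast : ∀ {k l : ℕ} {W : Type _} {G : SimpleGraph W}, G.IsCopWin (Fin k) → k = l →
      G.IsCopWin (Fin l) := fun h e => e ▸ h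
  have h₀ : ((cube 0).twoSection □ X).IsCopWin (Fin k) := by
    have : Unique V(cube 0) := inferInstanceAs (Unique V(piBox _))
    exact hk.of_iso ((SimpleGraph.boxProdComm _ _).trans (SimpleGraph.boxProdUnique _ _)).symm
  induction p using Nat.twoStepInduction with
  | zero => exact hcast h₀ (by simp)
  -- For odd `p` one factor `K₂` stays unpaired and costs a cop by itself.
  | one =>
    refine hcast (SimpleGraph.IsCopWin.fin_succ (.of_iso ?_ (h₀.boxProd
      ((connected_twoSection_cube 0).boxProd hX) hK
      ((SimpleGraph.isCopWin_of_forall_ne_adj hadj).guards hK)))) (by omega)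
    exact (SimpleGraph.boxProdComm _ _).trans ((SimpleGraph.boxProdAssoc _ _ _).symm.trans
      (SimpleGraph.boxProdCongrLeft (succIso 0).symm X))
  -- Two factors `K₂` are grouped into a four-cycle, which one additional cop guards.
  | more p hp _ =>
    refine hcast (SimpleGraph.IsCopWin.fin_succ (.of_iso ?_ (hp.boxProd
      ((connected_twoSection_cube p).boxProd hX) (hK.boxProd hK)
      (SimpleGraph.guards_boxProd_of_forall_eq_or hadj ?_)))) (by omega)
    · refine (SimpleGraph.boxProdComm _ _).trans ((SimpleGraph.boxProdAssoc _ _ _).symm.trans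
        (SimpleGraph.boxProdCongrLeft ?_ X))
      exact (SimpleGraph.boxProdAssoc _ _ _).trans ((SimpleGraph.boxProdComm _ _).trans
        ((SimpleGraph.boxProdCongrLeft (succIso p).symm K).trans
        ((SimpleGraph.boxProdComm _ _).trans (succIso (p + 1)).symm)))
    · rintro ⟨x, hx⟩ ⟨y, hy⟩ ⟨z, hz⟩ hxy
      simp only [ne_eq, Subtype.mk.injEq] at hxy ⊢
      omega

end Hypergraph

/-! ### Matching the two bounds -/

theorem corollary4p3 :
    (∀ (d : ℕ), 1 ≤ d → ∀ (α : Fin d → Type*) (T : ∀ i, Hypergraph (α i)),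
      (∀ i, V(T i).Finite) → (∀ i, (T i).IsHypertree) → (∀ i, 3 ≤ (T i).antiRank) →
      (Hypergraph.piBox T).copNumber = d) ∧
    (∀ (p q : ℕ), 1 ≤ q → ∀ (β : Fin q → Type*) (H : ∀ j, Hypergraph (β j)),
      (∀ j, V(H j).Finite) → (∀ j, (H j).IsUniformComplete) → (∀ j, 2 ≤ (H j).rank) →
      (∀ j, 3 ≤ V(H j).ncard) →
      ((Hypergraph.cube p).box (Hypergraph.piBox H)).copNumber = ⌈(p : ℚ) / 2⌉₊ + q) := by
  classical
  constructor
  · intro d hd α T hfin hT hrank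
    obtain ⟨d, rfl⟩ := Nat.exists_eq_add_of_le' hd
    have := (Hypergraph.connected_twoSection_piBox fun i => (hT i).1).nonempty
    exact Hypergraph.copNumber_eq
      (Hypergraph.isCopWin_twoSection_piBox (fun i => (hT i).1) fun i => (hT i).isCopWin (hfin i))
      (Hypergraph.hasSpreadNeighbors_twoSection_piBox fun i =>
        (hT i).hasSpreadNeighbors (hrank i)) (by omega)
  · intro p q hq β H hfin hH hrank hcard
    obtain ⟨q, rfl⟩ := Nat.exists_eq_add_of_le' hq
    have hadj : ∀ j x y, x ≠ y → (H j).twoSection.Adj x y := fun j _ _ => (hH j).adj (hrank j)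
    have hne : ∀ j, Nonempty V(H j) := fun j =>
      (Set.nonempty_of_ncard_ne_zero (by have := hcard j; omega)).to_subtype
    have hconn : ∀ j, (H j).twoSection.Connected := fun j =>
      SimpleGraph.connected_of_forall_ne_adj (hadj j)
    have hpi := Hypergraph.connected_twoSection_piBox hconn
    have hspread : ∀ j, (H j).twoSection.HasSpreadNeighbors 2 := fun j => .of_le_two le_rfl fun r => by
      have := (hfin j).fintype
      obtain ⟨N, hN, hN'⟩ := Finset.exists_subset_card_eq
        (s := (Finset.univ : Finset V(H j)).erase r) (n := 2) (by
          rw [Finset.card_erase_of_mem (Finset.mem_univ r), Finset.card_univ,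
            ← Nat.card_eq_fintype_card, Nat.card_coe_set_eq]
          have := hcard j
          omega)
      exact ⟨N, hN', fun v hv => hadj j r v (Finset.ne_of_mem_erase (hN hv)).symm⟩
    have e := Hypergraph.twoSectionBoxIso (Hypergraph.cube p) (Hypergraph.piBox H)
    have hwin := (Hypergraph.isCopWin_cube_boxProd hpi (Hypergraph.isCopWin_twoSection_piBox hconn
      fun j => SimpleGraph.isCopWin_of_forall_ne_adj (hadj j)) p).of_iso e.symm
    have := (e.connected_iff.2 ((Hypergraph.connected_twoSection_cube p).boxProd hpi)).nonempty
    rw [show ⌈(p : ℚ) / 2⌉₊ = (p + 1) / 2 by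
      refine le_antisymm (Nat.ceil_le.2 ?_) ?_
      · have h : (p : ℚ) ≤ ((2 * ((p + 1) / 2) : ℕ) : ℚ) := Nat.cast_le.2 (by omega)
        push_cast at h
        linarith
      · have h := Nat.le_ceil ((p : ℚ) / 2)
        have h' : (p : ℚ) ≤ ((2 * ⌈(p : ℚ) / 2⌉₊ : ℕ) : ℚ) := by
          push_cast
          linarith
        have := Nat.cast_le.1 h'
        omega]
    -- The spread is `p + 2q` for `q` complete factors, and twice the number of cops exceeds it by
    -- at most one, exactly when `p` is odd.
    exact Hypergraph.copNumber_eq hwin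
      (((Hypergraph.hasSpreadNeighbors_twoSection_cube p).boxProd
        (Hypergraph.hasSpreadNeighbors_twoSection_piBox hspread)).of_iso e.symm) (by omega)
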